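/- Let $n,p\ge 0$, let $A\in\mathbb{R}^{n\times n}$ be symmetric and let $V\in\mathbb{R}^{n\times p}$ have full column rank. Assume that $L_\varepsilon = A+\varepsilon^{-1}VV^{\top}$ is positive semi-definite for all sufficiently small $\varepsilon>0$ (for example, $A$ positive semi-definite). For $S\subseteq\{1,\dots,n\}$ write $L_S$ for the principal submatrix of $L$ with rows and columns in $S$ (with $\det L_\varnothing=1$), and $V_{S,:}$ for the submatrix of rows of $V$ in $S$. For a positive semi-definite $L\in\mathbb{R}^{n\times n}$, $\mathcal{X}\sim DPP(L)$ means that $\mathcal{X}$ is a random subset of $\{1,\dots,n\}$ with $\mathbb{P}(\mathcal{X}=S)=\det L_S/\sum_{T\subseteq\{1,\dots,n\}}\det L_T$ for all $S$. The pair $(A;V)$ is a nonnegative pair if $A$ is symmetric, $x^\top A x\ge 0$ for all $x$ with $V^\top x=0$, and $V$ has full column rank. For such a pair, $\mathcal{X}\sim DPP(A;V)$ (the extended L-ensemble) means that $\mathcal{X}$ is a random subset of $\{1,\dots,n\}$ with $$\mathbb{P}(\mathcal{X}=S)\ \propto\ (-1)^p\det\begin{pmatrix}A_S & V_{S,:}\\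 (V_{S,:})^\top & 0\end{pmatrix}\qquad\text{for all } S\subseteq\{1,\dots,n\}.$$ Let $\mathcal{X}_\varepsilon$ be random subsets of $\{1,\dots,n\}$ with $\mathcal{X}_\varepsilon\sim DPP(A+\varepsilon^{-1}VV^\top)$ for all sufficiently small $\varepsilon>0$. Then $(A;V)$ is a nonnegative pair, the extended L-ensemble $DPP(A;V)$ exists, and, as $\varepsilon\to0^+$, $\mathcal{X}_\varepsilon$ converges in distribution to $\mathcal{X}_\star\sim DPP(A;V)$; in particular $\mathbb{P}(\mathcal{X}_\varepsilon=S)\to\mathbb{P}(\mathcal{X}_\star=S)$ for every $S\subseteq\{1,\dots,n\}$. -/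

import Mathlib

open MeasureTheory Filter Topology

/-- The finite set of all subsets of the ground set `{0, …, n-1}` carries the discrete topology. -/
instance finsetFinTopologicalSpace (n : ℕ) : TopologicalSpace (Finset (Fin n)) := ⊥

instance finsetFinDiscreteTopology (n : ℕ) : DiscreteTopology (Finset (Fin n)) := ⟨rfl⟩

/-- The principal submatrix `L_S`, with rows and columns indexed by the elements of `S`. -/
def principalSubmatrix {n : ℕ} (L : Matrix (Fin n) (Fin n) ℝ) (S : Finset (Fin n)) :
    Matrix S S ℝ :=
  L.submatrix (fun i => (i : Fin n)) (fun i => (i : Fin n))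

/-- The submatrix `V_{S,:}` made of the full rows of `V` indexed by `S`. -/
def rowSubmatrix {n p : ℕ} (V : Matrix (Fin n) (Fin p) ℝ) (S : Finset (Fin n)) :
    Matrix S (Fin p) ℝ :=
  V.submatrix (fun i => (i : Fin n)) id

/-- The saddle-point matrix with blocks `L_S`, `V_{S,:}`, `(V_{S,:})ᵀ`, `0`. -/
def saddlePointMatrix {n p : ℕ} (L : Matrix (Fin n) (Fin n) ℝ) (V : Matrix (Fin n) (Fin p) ℝ)
    (S : Finset (Fin n)) : Matrix (S ⊕ Fin p) (S ⊕ Fin p) ℝ :=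
  Matrix.fromBlocks (principalSubmatrix L S) (rowSubmatrix V S) (rowSubmatrix V S).transpose 0

/-- A nonnegative pair `(L; V)`: `L` is symmetric and conditionally positive semi-definite with
respect to `V`, and `V` has full column rank. -/
structure IsNonnegativePair {n p : ℕ} (L : Matrix (Fin n) (Fin n) ℝ)
    (V : Matrix (Fin n) (Fin p) ℝ) : Prop where
  isSymm : L.IsSymm
  nonneg : ∀ x : Fin n → ℝ, V.transpose.mulVec x = 0 → 0 ≤ dotProduct x (L.mulVec x)
  fullColumnRank : LinearIndependent ℝ V.col

/-- The random subset `X`, defined on a probability space with probability `P`, is an L-ensemble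
based on the positive semi-definite matrix `L`, i.e. `X ∼ DPP(L)`. -/
structure IsLEnsemble {n : ℕ} (L : Matrix (Fin n) (Fin n) ℝ) {Ω : Type*} [MeasurableSpace Ω]
    (X : Ω → Finset (Fin n)) (P : Measure Ω) : Prop where
  posSemidef : L.PosSemidef
  isProbabilityMeasure : IsProbabilityMeasure P
  aemeasurable : AEMeasurable X P
  prob_eq : ∀ S : Finset (Fin n), P.real {ω | X ω = S} =
    (principalSubmatrix L S).det / ∑ T : Finset (Fin n), (principalSubmatrix L T).det

/-- The random subset `X`, defined on a probability space with probability `P`, is an extended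
L-ensemble based on the nonnegative pair `(L; V)`, i.e. `X ∼ DPP(L; V)`. -/
structure IsExtendedLEnsemble {n p : ℕ} (L : Matrix (Fin n) (Fin n) ℝ)
    (V : Matrix (Fin n) (Fin p) ℝ) {Ω : Type*} [MeasurableSpace Ω]
    (X : Ω → Finset (Fin n)) (P : Measure Ω) : Prop where
  isNonnegativePair : IsNonnegativePair L V
  isProbabilityMeasure : IsProbabilityMeasure P
  aemeasurable : AEMeasurable X P
  prob_propto : ∃ c : ℝ, 0 < c ∧ ∀ S : Finset (Fin n), P.real {ω | X ω = S} =
    c * ((-1) ^ p * (saddlePointMatrix L V S).det)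

section

open Matrix

/-! Replace the zero block of the saddle-point matrix by `-ε I`. Its Schur complement is the
principal minor of `A + ε⁻¹ V Vᵀ`, so `ε ^ p` times that minor is continuous up to `ε = 0`, where it
equals `extendedWeight` (`tendsto_pow_mul_det_principalSubmatrix`). The factor `ε ^ p` is the same
for every `S` and cancels on normalisation. The quotients therefore converge once the limiting total
weight is nonzero: the weights are limits of nonnegative numbers, and full column rank makes one of
them nonzero (`exists_det_saddlePointMatrix_ne_zero`). On a finite discrete space, convergence of
point masses is convergence in distribution. -/

/-- The unnormalised probability weight of `S` in the extended L-ensemble `DPP(A; V)`. -/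
noncomputable def extendedWeight {n p : ℕ} (A : Matrix (Fin n) (Fin n) ℝ)
    (V : Matrix (Fin n) (Fin p) ℝ) (S : Finset (Fin n)) : ℝ :=
  (-1) ^ p * (saddlePointMatrix A V S).det

/-- The Schur complement of the regularised saddle-point matrix is the principal submatrix of
`A + ε⁻¹ V Vᵀ`. -/
theorem det_regularised_saddlePoint {n p : ℕ} (A : Matrix (Fin n) (Fin n) ℝ)
    (V : Matrix (Fin n) (Fin p) ℝ) (S : Finset (Fin n)) {ε : ℝ} (hε : ε ≠ 0) :
    (fromBlocks (principalSubmatrix A S) (rowSubmatrix V S) (rowSubmatrix V S).transpose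
      ((-ε) • (1 : Matrix (Fin p) (Fin p) ℝ))).det =
      (-ε) ^ p * (principalSubmatrix (A + ε⁻¹ • (V * V.transpose)) S).det := by
  let _ : Invertible ((-ε) • (1 : Matrix (Fin p) (Fin p) ℝ)) :=
    ⟨(-ε⁻¹) • 1, by simp [smul_smul, hε], by simp [smul_smul, hε]⟩
  have hinv : ⅟((-ε) • (1 : Matrix (Fin p) (Fin p) ℝ)) = (-ε⁻¹) • 1 := rfl
  rw [det_fromBlocks₂₂, hinv]
  congr 1
  · rw [det_smul, det_one, mul_one, Fintype.card_fin]
  · congr 1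
    ext i j
    simp [principalSubmatrix, rowSubmatrix, mul_apply]

theorem tendsto_pow_mul_det_principalSubmatrix {n p : ℕ} (A : Matrix (Fin n) (Fin n) ℝ)
    (V : Matrix (Fin n) (Fin p) ℝ) (S : Finset (Fin n)) :
    Tendsto (fun ε : ℝ => ε ^ p * (principalSubmatrix (A + ε⁻¹ • (V * V.transpose)) S).det)
      (𝓝[>] 0) (𝓝 (extendedWeight A V S)) := by
  have hc : Continuous fun ε : ℝ => (-1 : ℝ) ^ p *
      (fromBlocks (principalSubmatrix A S) (rowSubmatrix V S) (rowSubmatrix V S).transpose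
        ((-ε) • (1 : Matrix (Fin p) (Fin p) ℝ))).det := by
    refine continuous_const.mul (Continuous.matrix_det ?_)
    exact Continuous.matrix_fromBlocks continuous_const continuous_const continuous_const
      (continuous_neg.smul continuous_const)
  have h := (hc.tendsto 0).mono_left (nhdsWithin_le_nhds (s := Set.Ioi 0))
  simp only [neg_zero, zero_smul] at h
  refine h.congr' ?_
  filter_upwards [self_mem_nhdsWithin] with ε hε
  rw [det_regularised_saddlePoint A V S (ne_of_gt hε), ← mul_assoc, ← mul_pow]
  simp

theorem det_principalSubmatrix_nonneg {n : ℕ} {L : Matrix (Fin n) (Fin n) ℝ} (hL : L.PosSemidef)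
    (S : Finset (Fin n)) : 0 ≤ (principalSubmatrix L S).det :=
  (hL.submatrix _).det_nonneg

theorem extendedWeight_nonneg {n p : ℕ} {A : Matrix (Fin n) (Fin n) ℝ}
    {V : Matrix (Fin n) (Fin p) ℝ}
    (hA : ∀ᶠ ε : ℝ in 𝓝[>] 0, (A + ε⁻¹ • (V * V.transpose)).PosSemidef) (S : Finset (Fin n)) :
    0 ≤ extendedWeight A V S := by
  refine ge_of_tendsto (tendsto_pow_mul_det_principalSubmatrix A V S) ?_
  filter_upwards [hA, self_mem_nhdsWithin] with ε h hε
  exact mul_nonneg (pow_nonneg (le_of_lt hε) p) (det_principalSubmatrix_nonneg h S)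

/-- A set of rows forming a basis of the row space yields a nonsingular saddle-point matrix. -/
theorem exists_det_saddlePointMatrix_ne_zero {n p : ℕ} (A : Matrix (Fin n) (Fin n) ℝ)
    {V : Matrix (Fin n) (Fin p) ℝ} (hV : LinearIndependent ℝ V.col) :
    ∃ S : Finset (Fin n), (saddlePointMatrix A V S).det ≠ 0 := by
  classical
  obtain ⟨κ, a, -, hspan, hli⟩ := exists_linearIndependent' ℝ V.row
  let S : Finset (Fin n) := Finset.univ.filter (· ∈ Set.range a)
  have hS : ∀ i, i ∈ S ↔ ∃ k, a k = i := by simp [S]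
  -- `g` is a section of `a`, so the rows of `V` in `S` form a subfamily of an independent family.
  choose g hg using fun i : S => (hS i).1 i.2
  have hgi : Function.Injective g := fun i j h => Subtype.ext (by rw [← hg i, ← hg j, h])
  have hrow : LinearIndependent ℝ (rowSubmatrix V S).row := by
    have hcomp : (V.row ∘ a) ∘ g = (rowSubmatrix V S).row := by
      funext i
      simp only [Function.comp_apply, hg]
      rfl
    rw [← hcomp]
    exact hli.comp g hgi
  refine ⟨S, fun h0 => ?_⟩
  obtain ⟨z, hz, hMz⟩ := exists_mulVec_eq_zero_iff.2 h0
  obtain ⟨x, y, rfl⟩ : ∃ x y, z = Sum.elim x y := ⟨z ∘ Sum.inl, z ∘ Sum.inr, by simp⟩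
  rw [saddlePointMatrix, fromBlocks_mulVec] at hMz
  have h1 := congrArg (· ∘ Sum.inl) hMz
  have h2 := congrArg (· ∘ Sum.inr) hMz
  simp only [Sum.elim_comp_inl, Sum.elim_comp_inr, zero_mulVec, add_zero] at h1 h2
  -- For a kernel vector `(x, y)`, the lower block says `V_Sᵀ x = 0`.
  have hx : x = 0 := by
    apply vecMul_injective_iff.2 hrow
    simp only [← mulVec_transpose, mulVec_zero]
    exact h2
  subst hx
  have hy : y = 0 := by
    apply mulVec_injective_iff.2 hV
    -- With `x = 0` the upper block is `V_S y = 0`. The rows in `S` span the row space, so `V y =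
    -- 0`.
    have hker : Submodule.span ℝ (Set.range V.row) ≤
        LinearMap.ker ((LinearMap.flip (dotProductBilin ℝ ℝ)) y) := by
      rw [← hspan, Submodule.span_le]
      rintro _ ⟨k, rfl⟩
      have := congrFun h1 ⟨a k, (hS _).2 ⟨k, rfl⟩⟩
      simp only [mulVec_zero, zero_add] at this
      exact this
    simp only [mulVec_zero]
    funext i
    exact hker (Submodule.subset_span ⟨i, rfl⟩)
  subst hy
  exact hz (by simp)

theorem sum_extendedWeight_pos {n p : ℕ} {A : Matrix (Fin n) (Fin n) ℝ}
    {V : Matrix (Fin n) (Fin p) ℝ} (hV : LinearIndependent ℝ V.col)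
    (hA : ∀ᶠ ε : ℝ in 𝓝[>] 0, (A + ε⁻¹ • (V * V.transpose)).PosSemidef) :
    0 < ∑ S : Finset (Fin n), extendedWeight A V S := by
  obtain ⟨S, hS⟩ := exists_det_saddlePointMatrix_ne_zero A hV
  refine Finset.sum_pos' (fun T _ => extendedWeight_nonneg hA T) ⟨S, Finset.mem_univ S, ?_⟩
  refine (extendedWeight_nonneg hA S).lt_of_ne' ?_
  simp [extendedWeight, hS]

/-- A single `ε` suffices: `V Vᵀ` is symmetric and vanishes on the kernel of `Vᵀ`. -/
theorem isNonnegativePair_of_eventually_posSemidef {n p : ℕ} {A : Matrix (Fin n) (Fin n) ℝ}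
    {V : Matrix (Fin n) (Fin p) ℝ} (hV : LinearIndependent ℝ V.col)
    (hA : ∀ᶠ ε : ℝ in 𝓝[>] 0, (A + ε⁻¹ • (V * V.transpose)).PosSemidef) :
    IsNonnegativePair A V := by
  obtain ⟨ε, hε⟩ := hA.exists
  refine ⟨?_, fun x hx => ?_, hV⟩
  · have h1 : (A + ε⁻¹ • (V * V.transpose)).IsSymm := by
      have := hε.isHermitian
      rwa [IsHermitian, conjTranspose_eq_transpose_of_trivial] at this
    have h2 : (ε⁻¹ • (V * V.transpose)).IsSymm := by
      rw [IsSymm, transpose_smul, transpose_mul, transpose_transpose]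
    simpa using h1.sub h2
  · have := hε.dotProduct_mulVec_nonneg x
    simpa [add_mulVec, smul_mulVec, ← mulVec_mulVec, hx] using this

end

theorem map_measureReal_singleton {n : ℕ} {Ω : Type*} [MeasurableSpace Ω] (P : Measure Ω)
    {X : Ω → Finset (Fin n)} (hX : AEMeasurable X P) (S : Finset (Fin n)) :
    (P.map X).real {S} = P.real {ω | X ω = S} := by
  rw [map_measureReal_apply_of_aemeasurable hX (measurableSet_singleton S)]
  rfl

theorem sum_measureReal_fiber {n : ℕ} {Ω : Type*} [MeasurableSpace Ω] (P : Measure Ω)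
    [IsProbabilityMeasure P] {X : Ω → Finset (Fin n)} (hX : AEMeasurable X P) :
    ∑ S : Finset (Fin n), P.real {ω | X ω = S} = 1 := by
  have := Measure.isProbabilityMeasure_map hX
  simp [← map_measureReal_singleton P hX]

theorem integral_map_eq_sum_fiber {n : ℕ} {Ω : Type*} [MeasurableSpace Ω] (P : Measure Ω)
    [IsProbabilityMeasure P] {X : Ω → Finset (Fin n)} (hX : AEMeasurable X P)
    (f : Finset (Fin n) → ℝ) :
    ∫ S, f S ∂(P.map X) = ∑ S : Finset (Fin n), P.real {ω | X ω = S} • f S := by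
  have := Measure.isProbabilityMeasure_map hX
  rw [integral_fintype .of_finite]
  simp only [map_measureReal_singleton P hX]

/-- Pointwise convergence of probability mass functions on a finite discrete space implies
convergence in distribution. -/
theorem tendstoInDistribution_of_tendsto_measureReal {n : ℕ} {ι : Type*} {l : Filter ι}
    {Ω : ι → Type*} [∀ i, MeasurableSpace (Ω i)] {P : ∀ i, Measure (Ω i)}
    [∀ i, IsProbabilityMeasure (P i)] {X : ∀ i, Ω i → Finset (Fin n)}
    (hX : ∀ i, AEMeasurable (X i) (P i)) {Ω' : Type*} [MeasurableSpace Ω'] {P' : Measure Ω'}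
    [IsProbabilityMeasure P'] {X' : Ω' → Finset (Fin n)} (hX' : AEMeasurable X' P')
    (h : ∀ S, Tendsto (fun i => (P i).real {ω | X i ω = S}) l (𝓝 (P'.real {ω | X' ω = S}))) :
    TendstoInDistribution X l X' P P' := by
  refine ⟨hX, hX', ProbabilityMeasure.tendsto_iff_forall_integral_tendsto.2 fun f => ?_⟩
  -- Each expectation is a finite sum of point masses times values of `f`.
  simp only [ProbabilityMeasure.coe_mk, integral_map_eq_sum_fiber _ (hX _),
    integral_map_eq_sum_fiber _ hX']
  exact tendsto_finsetSum _ fun S _ => (h S).smul_const _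

/-- Total mass one forces the proportionality constant, and also shows that the total weight is
nonzero. -/
theorem IsExtendedLEnsemble.prob_eq {n p : ℕ} {A : Matrix (Fin n) (Fin n) ℝ}
    {V : Matrix (Fin n) (Fin p) ℝ} {Ω : Type*} [MeasurableSpace Ω] {X : Ω → Finset (Fin n)}
    {P : Measure Ω} (h : IsExtendedLEnsemble A V X P) (S : Finset (Fin n)) :
    P.real {ω | X ω = S} = extendedWeight A V S / ∑ T : Finset (Fin n), extendedWeight A V T := by
  have := h.isProbabilityMeasure
  obtain ⟨c, -, hc⟩ := h.prob_propto
  have hsum := sum_measureReal_fiber P h.aemeasurable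
  change ∀ S, _ = c * extendedWeight A V S at hc
  simp only [hc, ← Finset.mul_sum] at hsum ⊢
  have hne := right_ne_zero_of_mul_eq_one hsum
  rw [eq_div_iff hne, mul_right_comm, hsum, one_mul]

theorem exists_probabilityMeasure_real_singleton {n : ℕ} {w : Finset (Fin n) → ℝ}
    (hw : ∀ S, 0 ≤ w S) (hsum : ∑ S, w S = 1) :
    ∃ μ : ProbabilityMeasure (Finset (Fin n)),
      ∀ S, (μ : Measure (Finset (Fin n))).real {S} = w S := by
  let q : PMF (Finset (Fin n)) := PMF.ofFintype (fun S => ENNReal.ofReal (w S)) (by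
    rw [← ENNReal.ofReal_sum_of_nonneg fun S _ => hw S, hsum, ENNReal.ofReal_one])
  refine ⟨⟨q.toMeasure, inferInstance⟩, fun S => ?_⟩
  rw [ProbabilityMeasure.coe_mk, Measure.real,
    PMF.toMeasure_apply_singleton _ _ (measurableSet_singleton S)]
  simp [q, hw S]

theorem exists_isExtendedLEnsemble {n p : ℕ} {A : Matrix (Fin n) (Fin n) ℝ}
    {V : Matrix (Fin n) (Fin p) ℝ} (hV : LinearIndependent ℝ V.col)
    (hA : ∀ᶠ ε : ℝ in 𝓝[>] 0, (A + ε⁻¹ • (V * V.transpose)).PosSemidef) :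
    ∃ μ : ProbabilityMeasure (Finset (Fin n)),
      IsExtendedLEnsemble A V (fun S : Finset (Fin n) => S) (μ : Measure (Finset (Fin n))) := by
  have hZ := sum_extendedWeight_pos hV hA
  obtain ⟨μ, hμ⟩ := exists_probabilityMeasure_real_singleton
    (w := fun S => (∑ T, extendedWeight A V T)⁻¹ * extendedWeight A V S)
    (fun S => mul_nonneg (inv_nonneg.2 hZ.le) (extendedWeight_nonneg hA S))
    (by rw [← Finset.mul_sum, inv_mul_cancel₀ hZ.ne'])
  exact ⟨μ, isNonnegativePair_of_eventually_posSemidef hV hA, inferInstance, aemeasurable_id,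
    _, inv_pos.2 hZ, hμ⟩

/-- The normalised principal minors of `A + ε⁻¹ V Vᵀ` converge to the probabilities of the
extended L-ensemble. -/
theorem tendsto_det_div_sum_det {n p : ℕ} {A : Matrix (Fin n) (Fin n) ℝ}
    {V : Matrix (Fin n) (Fin p) ℝ} (hV : LinearIndependent ℝ V.col)
    (hA : ∀ᶠ ε : ℝ in 𝓝[>] 0, (A + ε⁻¹ • (V * V.transpose)).PosSemidef) (S : Finset (Fin n)) :
    Tendsto (fun ε : ℝ => (principalSubmatrix (A + ε⁻¹ • (V * V.transpose)) S).det /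
      ∑ T : Finset (Fin n), (principalSubmatrix (A + ε⁻¹ • (V * V.transpose)) T).det) (𝓝[>] 0)
      (𝓝 (extendedWeight A V S / ∑ T : Finset (Fin n), extendedWeight A V T)) := by
  have hnum := tendsto_pow_mul_det_principalSubmatrix A V S
  have hden := tendsto_finsetSum Finset.univ
    fun T _ => tendsto_pow_mul_det_principalSubmatrix A V T
  refine (hnum.div hden (sum_extendedWeight_pos hV hA).ne').congr' ?_
  filter_upwards [self_mem_nhdsWithin] with ε hε
  rw [Pi.div_apply, ← Finset.mul_sum, mul_div_mul_left _ _ (pow_ne_zero p (ne_of_gt hε))]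

theorem mainTheorem7 {n p : ℕ} (A : Matrix (Fin n) (Fin n) ℝ) (V : Matrix (Fin n) (Fin p) ℝ)
    (hV : LinearIndependent ℝ V.col)
    (hA : ∀ᶠ ε : ℝ in 𝓝[>] 0, (A + ε⁻¹ • (V * V.transpose)).PosSemidef)
    {Ω : ℝ → Type*} [∀ ε, MeasurableSpace (Ω ε)] (P : ∀ ε, Measure (Ω ε))
    [∀ ε, IsProbabilityMeasure (P ε)] (X : ∀ ε, Ω ε → Finset (Fin n))
    (hXm : ∀ ε, AEMeasurable (X ε) (P ε))
    (hX : ∀ᶠ ε : ℝ in 𝓝[>] 0, IsLEnsemble (A + ε⁻¹ • (V * V.transpose)) (X ε) (P ε)) :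
    (∃ μ : ProbabilityMeasure (Finset (Fin n)),
      IsExtendedLEnsemble A V (fun S : Finset (Fin n) => S) (μ : Measure (Finset (Fin n)))) ∧
    ∀ {Ω' : Type*} [MeasurableSpace Ω'] (P' : Measure Ω') [IsProbabilityMeasure P']
      (X' : Ω' → Finset (Fin n)), IsExtendedLEnsemble A V X' P' →
        TendstoInDistribution X (𝓝[>] 0) X' P P' ∧
        ∀ S : Finset (Fin n), Tendsto (fun ε => (P ε).real {ω | X ε ω = S}) (𝓝[>] 0)
          (𝓝 (P'.real {ω | X' ω = S})) := by
  refine ⟨exists_isExtendedLEnsemble hV hA, fun P' _ X' hX' => ?_⟩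
  have hlim : ∀ S : Finset (Fin n), Tendsto (fun ε => (P ε).real {ω | X ε ω = S}) (𝓝[>] 0)
      (𝓝 (P'.real {ω | X' ω = S})) := fun S => by
    rw [hX'.prob_eq S]
    refine (tendsto_det_div_sum_det hV hA S).congr' ?_
    filter_upwards [hX] with ε hε
    exact (hε.prob_eq S).symm
  exact ⟨tendstoInDistribution_of_tendsto_measureReal hXm hX'.aemeasurable hlim, hlim⟩
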